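/- Let $N,K\ge 1$ be integers. A server holds $N$ files $W_1,\dots,W_N$, independent and uniform on $[2^F]=\{1,\dots,2^F\}$ ($F\ge 1$ an integer), and serves $K$ users. For $M\ge 0$ and $\mathbf R=(R_{\mathbf d})_{\mathbf d\in[N]^K}$ with all $R_{\mathbf d}\ge 0$, an $(M,\mathbf R)$ caching scheme with file size $F$ consists of cache contents $Z_k=z_k(W)\in[2^{\lfloor FM\rfloor}]$ for $k\in[K]$, update messages $X_{\mathbf d}=x_{\mathbf d}(W)\in[2^{\lfloor FR_{\mathbf d}\rfloor}]$ for $\mathbf d\in[N]^K$, and decoders producing, for each user $k$, an estimate $\hat W_{d_k}\in[2^F]$ from $(Z_k,X_{\mathbf d},\mathbf d)$. Its probability of error is $\max_{\mathbf d\in[N]^K}\max_{k\in[K]}\mathbb P(\hat W_{d_k}\ne W_{d_k})$. The tuple $(M,\mathbf R)$ is achievable if for every $\epsilon>0$ there are $(M,\mathbf R)$ caching schemes with arbitrarily large $F$ and probability of error less than $\epsilon$. Let $\mathcal R^\star$ be the closure of the set of achievable tuples, and let $$R^\star_{\mathsf{worst}}(M)=\min_{\mathbf R:\,(M,\mathbf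 R)\in\mathcal R^\star}\ \max_{\mathbf d\in[N]^K}R_{\mathbf d}.$$ Let $R_{\mathsf{MN}}(K,N,0)=\min\{K,N\}$ and, for $M\in(0,N]$, $$R_{\mathsf{MN}}(K,N,M)=(N-M)\cdot\min\Big\{\tfrac1M\Big(1-\big(1-\tfrac MN\big)^K\Big),\,1\Big\},$$ and let $\breve R_{\mathsf{MN}}(K,N,\cdot)$ be the lower convex envelope of $R_{\mathsf{MN}}(K,N,\cdot)$ on $[0,N]$, i.e. $\breve R_{\mathsf{MN}}(K,N,M)$ is the infimum of all $r$ such that $(M,r)$ lies in the convex hull of the graph of $R_{\mathsf{MN}}(K,N,\cdot)$ over $[0,N]$. Then for all $N\ge1$, $K\ge1$ and $M\in[0,N)$, the minimum defining $R^\star_{\mathsf{worst}}(M)$ is attained and positive, and $$\frac{\breve R_{\mathsf{MN}}(K,N,M)}{R^\star_{\mathsf{worst}}(M)}<4.7 .$$ -/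

import Mathlib

namespace CodedCaching

/-- A realization of the database: `N` files, each one of the `2 ^ F` values of `F` bits. -/
abbrev Files (N F : ℕ) : Type := Fin N → Fin (2 ^ F)

/-- A tuple of requests: user `k` asks for the file with index `d k`. -/
abbrev Requests (N K : ℕ) : Type := Fin K → Fin N

/-- An `(M, R)` caching scheme with file size `F`: the cache encoder, the update encoder and the
`K` decoders. Decoder `k` knows its cache content, the update message and all the requests. -/
structure Scheme (N K F : ℕ) (M : ℝ) (R : Requests N K → ℝ) where
  cache : (k : Fin K) → Files N F → Fin (2 ^ ⌊(F : ℝ) * M⌋₊)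
  update : (d : Requests N K) → Files N F → Fin (2 ^ ⌊(F : ℝ) * R d⌋₊)
  decode : (k : Fin K) → (d : Requests N K) → Fin (2 ^ ⌊(F : ℝ) * M⌋₊) →
    Fin (2 ^ ⌊(F : ℝ) * R d⌋₊) → Fin (2 ^ F)

namespace Scheme

variable {N K F : ℕ} {M : ℝ} {R : Requests N K → ℝ}

/-- The estimate that user `k` forms of the file it requested. -/
def estimate (S : Scheme N K F M R) (d : Requests N K) (k : Fin K) (w : Files N F) :
    Fin (2 ^ F) :=
  S.decode k d (S.cache k w) (S.update d w)

/-- The probability that user `k` fails to recover its file under the requests `d`. The files are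
independent and uniform, that is, the database is uniform on the finite set `Files N F`. -/
noncomputable def userError (S : Scheme N K F M R) (d : Requests N K) (k : Fin K) : ℝ :=
  ((Finset.univ.filter fun w : Files N F => S.estimate d k w ≠ w (d k)).card : ℝ) /
    (Fintype.card (Files N F) : ℝ)

/-- The probability of error: the maximum over all requests and all users. -/
noncomputable def errorProb (S : Scheme N K F M R) : ℝ :=
  ⨆ d : Requests N K, ⨆ k : Fin K, S.userError d k

end Scheme

/-- The (nonnegative) rate tuple `(M, R)` is achievable: for every `ε > 0` there are `(M, R)`
caching schemes, with arbitrarily large file sizes, whose probability of error is below `ε`. -/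
def Achievable (N K : ℕ) (M : ℝ) (R : Requests N K → ℝ) : Prop :=
  0 ≤ M ∧ (∀ d, 0 ≤ R d) ∧
    ∀ ε : ℝ, 0 < ε → ∀ F₀ : ℕ, ∃ F : ℕ, F₀ ≤ F ∧ 0 < F ∧
      ∃ S : Scheme N K F M R, S.errorProb < ε

/-- The optimal rate region: the closure of the set of achievable rate tuples. -/
def optimalRegion (N K : ℕ) : Set (ℝ × (Requests N K → ℝ)) :=
  closure {p | Achievable N K p.1 p.2}

/-- The values of `max_d R_d` over the rate tuples `(M, R)` of the optimal rate region. -/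
def worstCaseRates (N K : ℕ) (M : ℝ) : Set ℝ :=
  {r | ∃ R : Requests N K → ℝ, (M, R) ∈ optimalRegion N K ∧ r = ⨆ d, R d}

/-- The optimal worst-case rate at memory size `M`. -/
noncomputable def optimalWorstRate (N K : ℕ) (M : ℝ) : ℝ :=
  sInf (worstCaseRates N K M)

/-- The rate of the decentralized scheme of Maddah-Ali and Niesen, for `0 ≤ M ≤ N`. -/
noncomputable def rateMN (N K : ℕ) (M : ℝ) : ℝ :=
  if M = 0 then min (K : ℝ) (N : ℝ)
  else ((N : ℝ) - M) * min (1 / M * (1 - (1 - M / N) ^ K)) 1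

/-- The convexified rate: the least rate at memory size `M` that is obtained by time sharing
(convex combination) among the points `(m, rateMN N K m)`, `0 ≤ m ≤ N`. -/
noncomputable def convexifiedRateMN (N K : ℕ) (M : ℝ) : ℝ :=
  sInf {r | (M, r) ∈ convexHull ℝ ((fun m : ℝ => (m, rateMN N K m)) '' Set.Icc 0 (N : ℝ))}

end CodedCaching

/-!
The ratio is in fact at most `4`. Write `x = M / N` and `R⋆` for the optimal worst-case rate.

Converse: for every `1 ≤ l ≤ min N K`, `R⋆ ≥ l * (1 - l * x)` (`le_of_mem_optimalRegion`). Consider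
the `N` cyclic requests in which user `k` asks for file `j + k` modulo `N`, and only the first `l`
users. Fix the contents `z` of their caches and let `A` be the set of databases that produce `z` and
are decoded correctly for all these requests. For each `j` the update message determines the files
in the window `{j, …, j + l - 1}`, so the projection of `A` to this window has at most `2 ^ (F r)`
elements, where `r` bounds the update rates. Each file lies in exactly `l` windows, so Shearer's
inequality (`card_pow_le_prod_card_image_restrict`) gives `#A ≤ 2 ^ (F N r / l)`. There are at
most `2 ^ (F l M)` values of `z`, and at a small probability of error the sets `A` together cover
half of the `2 ^ (F N)` databases; letting `F → ∞`, `N ≤ l M + N r / l`. This counting argument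
takes the place of Fano's inequality. Shearer's inequality is the counting-measure case of Finner's
inequality (`lmarginal_prod_rpow_le`), which follows by integrating out one coordinate at a time
with Hölder's inequality.

Comparison (`convexifiedRateMN_le_four_mul`): let `m = min K N`. If `m x ≤ 1 / 2`, the chord from
`(0, m)` to `(N, 0)` bounds the convexified rate by `m (1 - x) ≤ 2 m (1 - m x)`. Otherwise the
integer `l` nearest to `1 / (2 x)` satisfies `1 ≤ l ≤ m` and `|2 l x - 1| ≤ x`, so
`l (1 - l x) = (1 - (1 - 2 l x) ^ 2) / (4 x) ≥ (1 - x ^ 2) / (4 x)`, while the rate is at most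
`(1 - x) / x`.

The minimum is attained because the region is closed, its rates are nonnegative, and sending all
files (`R = N`) is achievable, so that only a compact set of rate tuples matters.
-/

/-! ### Finner's and Shearer's inequalities -/

namespace MeasureTheory

open scoped ENNReal

/-- **Finner's inequality**, for partial integrals: if each `f j` depends only on the coordinates
in `S j`, and every coordinate that is integrated out lies in exactly `l` of the sets `S j`, then
the integral of the product of the `l`-th roots is at most the product of the `l`-th roots of the
integrals. -/
theorem lmarginal_prod_rpow_le {δ J : Type*} {X : δ → Type*} [∀ i, MeasurableSpace (X i)]
    (μ : ∀ i, Measure (X i)) [∀ i, SigmaFinite (μ i)] [DecidableEq δ] [Fintype J]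
    (S : J → Finset δ) {l : ℕ} (hl : 0 < l) (T : Finset δ)
    (hcov : ∀ i ∈ T, (Finset.univ.filter fun j => i ∈ S j).card = l)
    (f : J → (∀ i, X i) → ℝ≥0∞) (hf : ∀ j, Measurable (f j))
    (hdep : ∀ j, ∀ i ∉ S j, ∀ x y, f j (Function.update x i y) = f j x) (x : ∀ i, X i) :
    (∫⋯∫⁻_T, (fun x => ∏ j, f j x ^ (1 / (l : ℝ))) ∂μ) x ≤
      ∏ j, ((∫⋯∫⁻_(T ∩ S j), f j ∂μ) x) ^ (1 / (l : ℝ)) := by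
  induction T using Finset.induction generalizing x with
  | empty => simp
  | insert i T hi ih =>
    have hmeas : Measurable (fun x => ∏ j, f j x ^ (1 / (l : ℝ))) :=
      Finset.measurable_fun_prod _ fun j _ => (hf j).pow_const _
    rw [lmarginal_insert _ hmeas hi]
    set g : J → (∀ i, X i) → ℝ≥0∞ := fun j => ∫⋯∫⁻_(T ∩ S j), f j ∂μ with hg
    have hgm : ∀ j, Measurable (g j) := fun j => (hf j).lmarginal μ
    have hin : ∀ j, i ∈ S j →
        (∫⋯∫⁻_(insert i T ∩ S j), f j ∂μ) x = ∫⁻ y, g j (Function.update x i y) ∂μ i := by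
      intro j hj
      rw [Finset.insert_inter_of_mem hj, lmarginal_insert _ (hf j) (by simp [hi])]
    have hout : ∀ j, i ∉ S j → ∀ y, g j (Function.update x i y) = g j x := by
      intro j hj y
      rw [hg]
      simp only
      rw [lmarginal_update_of_notMem (hf j) (by simp [hi])]
      congr 1
      ext z
      exact hdep j i hj z y
    calc ∫⁻ y, (∫⋯∫⁻_T, (fun x => ∏ j, f j x ^ (1 / (l : ℝ))) ∂μ) (Function.update x i y) ∂μ i
        ≤ ∫⁻ y, ∏ j, g j (Function.update x i y) ^ (1 / (l : ℝ)) ∂μ i :=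
          lintegral_mono fun y => ih (fun k hk => hcov k (Finset.mem_insert_of_mem hk)) _
      _ = ∫⁻ y, (∏ j with i ∉ S j, g j x ^ (1 / (l : ℝ))) *
            ∏ j with i ∈ S j, g j (Function.update x i y) ^ (1 / (l : ℝ)) ∂μ i := by
          refine lintegral_congr fun y => ?_
          rw [← Finset.prod_filter_mul_prod_filter_not _ (fun j => i ∈ S j), mul_comm]
          congr 1
          refine Finset.prod_congr rfl fun j hj => ?_
          rw [hout j (by simpa using hj)]
      _ = (∏ j with i ∉ S j, g j x ^ (1 / (l : ℝ))) *
            ∫⁻ y, ∏ j with i ∈ S j, g j (Function.update x i y) ^ (1 / (l : ℝ)) ∂μ i := by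
          refine lintegral_const_mul _ ?_
          exact Finset.measurable_fun_prod _ fun j _ =>
            ((hgm j).comp (measurable_update x)).pow_const _
      _ ≤ (∏ j with i ∉ S j, g j x ^ (1 / (l : ℝ))) *
            ∏ j with i ∈ S j, (∫⁻ y, g j (Function.update x i y) ∂μ i) ^ (1 / (l : ℝ)) := by
          gcongr
          refine ENNReal.lintegral_prod_norm_pow_le _
            (fun j _ => ((hgm j).comp (measurable_update x)).aemeasurable) ?_ (by simp)
          rw [Finset.sum_const, hcov i (Finset.mem_insert_self i T), nsmul_eq_mul]
          field_simp
      _ = _ := by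
          rw [← Finset.prod_filter_mul_prod_filter_not Finset.univ (fun j => i ∈ S j), mul_comm]
          congr 1
          · exact Finset.prod_congr rfl fun j hj => by rw [hin j (by simpa using hj)]
          · refine Finset.prod_congr rfl fun j hj => ?_
            rw [Finset.insert_inter_of_notMem (by simpa using hj)]

/-- **Shearer's inequality**, combinatorial form, for families of coordinate sets covering every
coordinate exactly `l` times. -/
theorem card_pow_le_prod_card_image_restrict {ι J α : Type*} [Fintype ι] [DecidableEq ι]
    [Fintype J] [Finite α] [DecidableEq α] (S : J → Finset ι) {l : ℕ} (hl : 0 < l)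
    (hcov : ∀ i, (Finset.univ.filter fun j => i ∈ S j).card = l) (A : Finset (ι → α)) :
    A.card ^ l ≤ ∏ j, (A.image (S j).restrict).card := by
  have := Fintype.ofFinite α
  obtain rfl | ⟨x₀, -⟩ := A.eq_empty_or_nonempty
  · simp [hl.ne']
  let _ : MeasurableSpace α := ⊤
  have : MeasurableSingletonClass α := ⟨fun _ => trivial⟩
  let ν : ι → Measure α := fun _ => Measure.count
  -- `f j` is the indicator function of the cylinder over the projection of `A` to `S j`.
  let f : J → (ι → α) → ENNReal :=
    fun j x => if (S j).restrict x ∈ A.image (S j).restrict then 1 else 0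
  have key := lmarginal_prod_rpow_le ν S hl Finset.univ (fun i _ => hcov i) f
    (fun j => measurable_of_finite _) (by
      intro j i hi x y
      have : (S j).restrict (Function.update x i y) = (S j).restrict x := by
        ext k
        have : (k : ι) ≠ i := fun h => hi (h ▸ k.2)
        simp [this]
      simp only [f, this]) x₀
  have hS : ∀ j, (∫⋯∫⁻_S j, f j ∂ν) x₀ = (A.image (S j).restrict).card := by
    intro j
    have hr : ∀ y : S j → α, (S j).restrict (Function.updateFinset x₀ (S j) y) = y := by
      intro y
      ext k
      simp [Function.updateFinset]
    simp only [lmarginal, f, hr]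
    rw [lintegral_fintype]
    simp only [ν, Measure.pi_singleton, Measure.count_singleton]
    simp only [Finset.prod_const_one, mul_one, Finset.sum_boole, Nat.cast_inj]
    congr 1
    ext y
    simp
  have hL : (A.card : ENNReal) ≤
      (∫⋯∫⁻_Finset.univ, (fun x => ∏ j, f j x ^ (1 / (l : ℝ))) ∂ν) x₀ := by
    rw [← lintegral_eq_lmarginal_univ, lintegral_fintype]
    calc (A.card : ENNReal) = ∑ x ∈ A, 1 := by simp
      _ ≤ ∑ x ∈ A, (∏ j, f j x ^ (1 / (l : ℝ))) * Measure.pi ν {x} := by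
        refine Finset.sum_le_sum fun x hx => ?_
        have : ∀ j, f j x = 1 := fun j => if_pos (Finset.mem_image_of_mem _ hx)
        simp [this, ν, Measure.pi_singleton]
      _ ≤ _ := Finset.sum_le_sum_of_subset (Finset.subset_univ _)
  have h := hL.trans key
  simp only [Finset.univ_inter, hS] at h
  have hl' : (l : ℝ) ≠ 0 := by positivity
  rw [ENNReal.prod_rpow_of_nonneg (by positivity)] at h
  have h2 := ENNReal.rpow_le_rpow h (show (0 : ℝ) ≤ l by positivity)
  rw [← ENNReal.rpow_mul, one_div, inv_mul_cancel₀ hl', ENNReal.rpow_one,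
    ENNReal.rpow_natCast] at h2
  exact_mod_cast h2

end MeasureTheory

/-! ### The converse bound -/

namespace CodedCaching

/-- The `l` cyclically consecutive file indices starting at `j`. -/
def window {N l : ℕ} (hl : l ≤ N) (j : Fin N) : Finset (Fin N) :=
  Finset.univ.image fun a : Fin l => j + Fin.castLE hl a

theorem card_filter_mem_window {N l : ℕ} [NeZero N] (hl : l ≤ N) (i : Fin N) :
    (Finset.univ.filter fun j => i ∈ window hl j).card = l := by
  have : (Finset.univ.filter fun j => i ∈ window hl j) =
      Finset.univ.image fun a : Fin l => i - Fin.castLE hl a := by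
    ext j
    simp only [window, Finset.mem_filter, Finset.mem_univ, true_and, Finset.mem_image]
    exact exists_congr fun a => by rw [sub_eq_iff_eq_add, eq_comm]
  rw [this, Finset.card_image_of_injective _ fun a b h => by simpa using h]
  simp

/-- The requests in which user `k` asks for file `j + k`, modulo `N`. The first `l ≤ N` users ask
for the files in `window _ j`. -/
def cyclicRequests (N K : ℕ) [NeZero N] (j : Fin N) : Requests N K :=
  fun k => j + Fin.ofNat N k

namespace Scheme

variable {N K F : ℕ} {M : ℝ} {R : Requests N K → ℝ}

theorem userError_le_errorProb (S : Scheme N K F M R) (d : Requests N K) (k : Fin K) :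
    S.userError d k ≤ S.errorProb :=
  (le_ciSup (f := fun k => S.userError d k) (Set.finite_range _).bddAbove k).trans
    (le_ciSup (f := fun d => ⨆ k, S.userError d k) (Set.finite_range _).bddAbove d)

/-- The databases for which every user decodes correctly under each of the `N` cyclic requests. -/
def goodFiles [NeZero N] (S : Scheme N K F M R) : Finset (Files N F) :=
  Finset.univ.filter fun w =>
    ∀ j k, S.estimate (cyclicRequests N K j) k w = w (cyclicRequests N K j k)

theorem card_goodFiles_compl_le [NeZero N] (S : Scheme N K F M R) :
    (((S.goodFiles)ᶜ).card : ℝ) ≤ N * K * S.errorProb * Fintype.card (Files N F) := by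
  have hsub : (S.goodFiles)ᶜ ⊆ Finset.univ.biUnion fun p : Fin N × Fin K =>
      Finset.univ.filter fun w : Files N F =>
        S.estimate (cyclicRequests N K p.1) p.2 w ≠ w (cyclicRequests N K p.1 p.2) := by
    intro w hw
    simpa [goodFiles] using hw
  have hcard : (0 : ℝ) < Fintype.card (Files N F) := by exact_mod_cast Fintype.card_pos
  calc (((S.goodFiles)ᶜ).card : ℝ)
      ≤ ∑ p : Fin N × Fin K, ((Finset.univ.filter fun w : Files N F =>
          S.estimate (cyclicRequests N K p.1) p.2 w ≠
            w (cyclicRequests N K p.1 p.2)).card : ℝ) := by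
        exact_mod_cast (Finset.card_le_card hsub).trans Finset.card_biUnion_le
    _ ≤ ∑ _p : Fin N × Fin K, S.errorProb * Fintype.card (Files N F) := by
        refine Finset.sum_le_sum fun p _ => ?_
        rw [← div_le_iff₀ hcard]
        exact S.userError_le_errorProb _ _
    _ = _ := by simp [mul_assoc]

theorem half_card_le_card_goodFiles [NeZero N] (S : Scheme N K F M R)
    (h : N * K * S.errorProb ≤ 1 / 2) : (2 : ℝ) ^ (N * F) / 2 ≤ S.goodFiles.card := by
  have h1 := S.card_goodFiles_compl_le
  have h2 : (S.goodFiles.card : ℝ) + (S.goodFiles)ᶜ.card = Fintype.card (Files N F) := by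
    exact_mod_cast Finset.card_add_card_compl _
  have h3 : (Fintype.card (Files N F) : ℝ) = 2 ^ (N * F) := by
    simp [pow_mul, mul_comm N F]
  rw [h3] at h1 h2
  have : (0 : ℝ) < 2 ^ (N * F) := by positivity
  nlinarith

/-- Given the cache contents `z` of the first `l` users, a correctly decoded database is determined
on a window by the update message for the corresponding requests. -/
theorem card_image_restrict_window_le [NeZero N] (S : Scheme N K F M R) {l : ℕ} (hlN : l ≤ N)
    (hlK : l ≤ K) (z : Fin l → Fin (2 ^ ⌊(F : ℝ) * M⌋₊)) (j : Fin N) :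
    ((S.goodFiles.filter fun w => (fun a => S.cache (Fin.castLE hlK a) w) = z).image
      (window hlN j).restrict).card ≤ 2 ^ ⌊(F : ℝ) * R (cyclicRequests N K j)⌋₊ := by
  set A := S.goodFiles.filter fun w => (fun a => S.cache (Fin.castLE hlK a) w) = z with hA
  set U := A.image (S.update (cyclicRequests N K j)) with hU
  have hUc : U.card ≤ 2 ^ ⌊(F : ℝ) * R (cyclicRequests N K j)⌋₊ := by
    simpa using Finset.card_le_univ U
  refine le_trans ?_ hUc
  refine Finset.card_le_card_of_forall_subsingleton
    (fun y u => ∃ w ∈ A, (window hlN j).restrict w = y ∧ S.update (cyclicRequests N K j) w = u)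
    ?_ ?_
  · intro y hy
    obtain ⟨w, hw, rfl⟩ := Finset.mem_image.1 hy
    exact ⟨_, Finset.mem_image_of_mem _ hw, w, hw, rfl, rfl⟩
  · rintro u - y ⟨-, w, hw, rfl, hu⟩ y' ⟨-, w', hw', rfl, hu'⟩
    ext ⟨i, hi⟩ : 1
    obtain ⟨a, -, rfl⟩ := Finset.mem_image.1 hi
    have hd : cyclicRequests N K j (Fin.castLE hlK a) = j + Fin.castLE hlN a := by
      simp only [cyclicRequests]
      congr 1
      ext
      simp [Nat.mod_eq_of_lt (a.2.trans_le hlN)]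
    simp only [hA, goodFiles, Finset.mem_filter, Finset.mem_univ, true_and] at hw hw'
    have e := hw.1 j (Fin.castLE hlK a)
    have e' := hw'.1 j (Fin.castLE hlK a)
    have hz := congrFun (hw.2.trans hw'.2.symm) a
    simp only [estimate, hu, hu', hd] at e e' hz
    simp only [Finset.restrict]
    rw [← e, ← e', hz]

/-- Shearer's inequality bounds the correctly decoded databases with given contents of the first `l`
caches; summing over these contents bounds them all. -/
theorem card_goodFiles_le [NeZero N] (S : Scheme N K F M R) {l : ℕ} (hl : 0 < l) (hlN : l ≤ N)
    (hlK : l ≤ K) (hM : 0 ≤ M) {r : ℝ} (hR : ∀ d, 0 ≤ R d) (hr : ∀ d, R d ≤ r) :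
    (S.goodFiles.card : ℝ) ≤ 2 ^ (F * (l * M + N * r / l)) := by
  have hl' : (0 : ℝ) < l := by positivity
  have hpow : ∀ x : ℝ, 0 ≤ x → (2 : ℝ) ^ ⌊(F : ℝ) * x⌋₊ ≤ 2 ^ (F * x) := by
    intro x hx
    rw [← Real.rpow_natCast]
    exact Real.rpow_le_rpow_of_exponent_le (by norm_num) (Nat.floor_le (by positivity))
  have hfib : ∀ z : Fin l → Fin (2 ^ ⌊(F : ℝ) * M⌋₊),
      ((S.goodFiles.filter fun w => (fun a => S.cache (Fin.castLE hlK a) w) = z).card : ℝ) ≤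
        2 ^ (F * (N * r / l)) := by
    intro z
    have h := MeasureTheory.card_pow_le_prod_card_image_restrict (window hlN) hl
      (card_filter_mem_window hlN)
      (S.goodFiles.filter fun w => (fun a => S.cache (Fin.castLE hlK a) w) = z)
    have h2 : ((S.goodFiles.filter fun w =>
        (fun a => S.cache (Fin.castLE hlK a) w) = z).card : ℝ) ^ l ≤
        ((2 : ℝ) ^ (F * (N * r / l))) ^ l := by
      calc _ ≤ ∏ j : Fin N, (2 : ℝ) ^ ⌊(F : ℝ) * R (cyclicRequests N K j)⌋₊ := by
            exact_mod_cast h.trans (Finset.prod_le_prod' fun j _ =>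
              S.card_image_restrict_window_le hlN hlK z j)
        _ ≤ ∏ _j : Fin N, (2 : ℝ) ^ (F * r) := by
            refine Finset.prod_le_prod (fun _ _ => by positivity) fun j _ => ?_
            refine (hpow _ (hR _)).trans
              (Real.rpow_le_rpow_of_exponent_le (by norm_num) ?_)
            gcongr
            exact hr _
        _ = _ := by
            rw [Finset.prod_const, Finset.card_univ, Fintype.card_fin, ← Real.rpow_natCast,
              ← Real.rpow_natCast, ← Real.rpow_mul (by norm_num), ← Real.rpow_mul (by norm_num)]
            congr 1
            field_simp
    exact le_of_pow_le_pow_left₀ hl.ne' (by positivity) h2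
  rw [Finset.card_eq_sum_card_fiberwise (f := fun w a => S.cache (Fin.castLE hlK a) w)
    (t := Finset.univ) (fun _ _ => by simp)]
  push_cast
  calc _ ≤ ∑ _z : Fin l → Fin (2 ^ ⌊(F : ℝ) * M⌋₊), (2 : ℝ) ^ (F * (N * r / l)) :=
        Finset.sum_le_sum fun z _ => hfib z
    _ = ((2 : ℝ) ^ ⌊(F : ℝ) * M⌋₊) ^ l * 2 ^ (F * (N * r / l)) := by simp
    _ ≤ ((2 : ℝ) ^ (F * M)) ^ l * 2 ^ (F * (N * r / l)) := by
        gcongr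
        exact hpow M hM
    _ = _ := by
        rw [← Real.rpow_natCast, ← Real.rpow_mul (by norm_num), ← Real.rpow_add (by norm_num)]
        congr 1
        ring

end Scheme

/-- The files must fit into `l` caches and `N / l` update messages, although `l` need not
divide `N`. -/
theorem Achievable.le_of_forall_le {N K : ℕ} {M r : ℝ} {R : Requests N K → ℝ}
    (h : Achievable N K M R) {l : ℕ} (hl : 0 < l) (hlN : l ≤ N) (hlK : l ≤ K)
    (hr : ∀ d, R d ≤ r) : (N : ℝ) ≤ l * M + N * r / l := by
  have : NeZero N := ⟨by omega⟩
  obtain ⟨hM, hR, h⟩ := h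
  by_contra! hlt
  set δ : ℝ := N - (l * M + N * r / l) with hδ
  have hδ0 : 0 < δ := by linarith
  obtain ⟨F₀, hF₀⟩ := exists_nat_gt (1 / δ)
  have hN : (0 : ℝ) < N := by exact_mod_cast (by omega : 0 < N)
  have hK : (0 : ℝ) < K := by exact_mod_cast (by omega : 0 < K)
  -- By the union bound over the `N * K` pairs of a cyclic request and a user, this error level
  -- keeps at least half of the databases good; halving costs one bit, negligible for large `F`.
  obtain ⟨F, hF, -, S, hS⟩ := h (1 / (2 * (N * K))) (by positivity) F₀
  have h1 := S.half_card_le_card_goodFiles (by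
    rw [lt_div_iff₀ (by positivity)] at hS
    linarith)
  have h2 := h1.trans (S.card_goodFiles_le hl hlN hlK hM hR hr)
  have h3 : (2 : ℝ) ^ ((N : ℝ) * F - 1) ≤ 2 ^ (F * (l * M + N * r / l)) := by
    rw [Real.rpow_sub (by norm_num), Real.rpow_one]
    exact_mod_cast h2
  rw [Real.rpow_le_rpow_left_iff (by norm_num)] at h3
  have h4 : (F : ℝ) * δ ≤ 1 := by rw [hδ]; linarith
  have h5 : 1 < (F : ℝ) * δ := by
    rw [div_lt_iff₀ hδ0] at hF₀
    have : (F₀ : ℝ) ≤ F := by exact_mod_cast hF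
    nlinarith
  linarith

/-- The converse bound `max_d R_d ≥ l (1 - l M / N)`, extended to the closure of the set of
achievable tuples. -/
theorem le_of_mem_optimalRegion {N K : ℕ} {p : ℝ × (Requests N K → ℝ)}
    (hp : p ∈ optimalRegion N K) {l : ℕ} (hl : 0 < l) (hlN : l ≤ N) (hlK : l ≤ K) :
    (l : ℝ) * (1 - l * (p.1 / N)) ≤ ⨆ d, p.2 d := by
  have hN : (0 : ℝ) < N := by exact_mod_cast (by omega : 0 < N)
  have hl' : (0 : ℝ) < l := by exact_mod_cast hl
  have : Nonempty (Fin N) := ⟨⟨0, by omega⟩⟩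
  have hcont : Continuous fun p : ℝ × (Requests N K → ℝ) => ⨆ d, p.2 d := by
    simp_rw [← Finset.sup'_univ_eq_ciSup]
    exact Continuous.finset_sup'_apply _ fun d _ => by fun_prop
  have hclosed : IsClosed {p : ℝ × (Requests N K → ℝ) |
      (l : ℝ) * (1 - l * (p.1 / N)) ≤ ⨆ d, p.2 d} :=
    isClosed_le (by fun_prop) hcont
  refine closure_minimal (fun q hq => ?_) hclosed hp
  have h := Achievable.le_of_forall_le hq hl hlN hlK
    fun d => le_ciSup (Set.finite_range q.2).bddAbove d
  have e : (l : ℝ) * q.1 + N * (⨆ d, q.2 d) / l =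
      N * (l * (q.1 / N) + (⨆ d, q.2 d) / l) := by
    field_simp
  rw [e, le_mul_iff_one_le_right hN, ← sub_le_iff_le_add', le_div_iff₀ hl'] at h
  simpa [mul_comm] using h

end CodedCaching

/-! ### Existence of the minimum -/

namespace CodedCaching

/-- Sending the whole database is an error-free scheme, whatever the memory size. -/
theorem achievable_const (N K : ℕ) (hN : 1 ≤ N) (hK : 1 ≤ K) {M : ℝ} (hM : 0 ≤ M) :
    Achievable N K M fun _ => (N : ℝ) := by
  have : Nonempty (Fin N) := ⟨⟨0, hN⟩⟩
  have : Nonempty (Fin K) := ⟨⟨0, hK⟩⟩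
  refine ⟨hM, fun _ => by positivity, fun ε hε F₀ => ⟨F₀ + 1, by omega, by omega, ?_⟩⟩
  have hcard : Fintype.card (Files N (F₀ + 1)) = 2 ^ ⌊((F₀ + 1 : ℕ) : ℝ) * N⌋₊ := by
    rw [← Nat.cast_mul, Nat.floor_natCast]
    simp [pow_mul]
  let e := Fintype.equivFinOfCardEq hcard
  let S : Scheme N K (F₀ + 1) M fun _ => (N : ℝ) :=
    { cache := fun _ _ => 0
      update := fun _ w => e w
      decode := fun k d _ x => e.symm x (d k) }
  refine ⟨S, ?_⟩
  have h : S.errorProb = 0 := by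
    simp [Scheme.errorProb, Scheme.userError, Scheme.estimate, S]
  rwa [h]

theorem nonneg_of_mem_optimalRegion {N K : ℕ} {p : ℝ × (Requests N K → ℝ)}
    (hp : p ∈ optimalRegion N K) (d : Requests N K) : 0 ≤ p.2 d := by
  have hclosed : IsClosed {p : ℝ × (Requests N K → ℝ) | 0 ≤ p.2 d} :=
    isClosed_le (by fun_prop) (by fun_prop)
  exact closure_minimal (fun q hq => hq.2.1 d) hclosed hp

/-- Tuples with a rate above `N` do no better than sending all files, so the infimum is that of a
continuous function over a compact set. -/
theorem exists_isLeast_worstCaseRates (N K : ℕ) (hN : 1 ≤ N) (hK : 1 ≤ K) {M : ℝ} (hM : 0 ≤ M) :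
    ∃ r, IsLeast (worstCaseRates N K M) r := by
  have : Nonempty (Fin N) := ⟨⟨0, hN⟩⟩
  set C : Set (Requests N K → ℝ) :=
    {R | (M, R) ∈ optimalRegion N K} ∩ Set.Icc 0 (fun _ => (N : ℝ)) with hC
  have hCc : IsCompact C :=
    isCompact_Icc.inter_left (isClosed_closure.preimage (by fun_prop))
  have hN_mem : (fun _ => (N : ℝ)) ∈ C :=
    ⟨subset_closure (achievable_const N K hN hK hM), fun _ => by simp, le_rfl⟩
  have hcont : Continuous fun R : Requests N K → ℝ => ⨆ d, R d := by
    simp_rw [← Finset.sup'_univ_eq_ciSup]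
    exact Continuous.finset_sup'_apply _ fun d _ => by fun_prop
  obtain ⟨R, hR, hmin⟩ := hCc.exists_isMinOn ⟨_, hN_mem⟩ hcont.continuousOn
  refine ⟨⨆ d, R d, ⟨R, hR.1, rfl⟩, ?_⟩
  rintro _ ⟨R', hR', rfl⟩
  by_cases h : ∀ d, R' d ≤ N
  · exact hmin ⟨hR', fun d => nonneg_of_mem_optimalRegion hR' d, h⟩
  · push Not at h
    obtain ⟨d, hd⟩ := h
    have h1 : (⨆ d, R d) ≤ ⨆ _ : Requests N K, (N : ℝ) := hmin hN_mem
    rw [ciSup_const] at h1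
    exact h1.trans (hd.le.trans (le_ciSup (Set.finite_range R').bddAbove d))

/-! ### Comparison with the convexified rate -/

theorem rateMN_nonneg (N K : ℕ) {M : ℝ} (hM : M ∈ Set.Icc 0 (N : ℝ)) : 0 ≤ rateMN N K M := by
  obtain ⟨h0, h1⟩ := hM
  unfold rateMN
  split_ifs with h
  · positivity
  · have hx : M / N ≤ 1 := div_le_one_of_le₀ h1 (by positivity)
    have hp : (1 - M / N) ^ K ≤ 1 :=
      pow_le_one₀ (by linarith) (by linarith [div_nonneg h0 (Nat.cast_nonneg N : (0 : ℝ) ≤ N)])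
    exact mul_nonneg (by linarith)
      (le_min (mul_nonneg (by positivity) (by linarith)) zero_le_one)

theorem convexifiedRateMN_le {N K : ℕ} {M r : ℝ}
    (h : (M, r) ∈ convexHull ℝ ((fun m : ℝ => (m, rateMN N K m)) '' Set.Icc 0 (N : ℝ))) :
    convexifiedRateMN N K M ≤ r := by
  refine csInf_le ⟨0, fun s hs => ?_⟩ h
  have hconv : Convex ℝ {p : ℝ × ℝ | 0 ≤ p.2} :=
    convex_halfSpace_ge (LinearMap.snd ℝ ℝ ℝ).isLinear 0
  refine convexHull_min ?_ hconv hs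
  rintro _ ⟨m, hm, rfl⟩
  exact rateMN_nonneg N K hm

theorem convexifiedRateMN_le_chord {N : ℕ} (K : ℕ) (hN : 1 ≤ N) {M : ℝ} (hM : 0 ≤ M)
    (hMN : M ≤ N) : convexifiedRateMN N K M ≤ (1 - M / N) * min (K : ℝ) N := by
  have hN' : (0 : ℝ) < N := by exact_mod_cast hN
  apply convexifiedRateMN_le
  have h0 := subset_convexHull ℝ _ (Set.mem_image_of_mem (fun m : ℝ => (m, rateMN N K m))
    (Set.left_mem_Icc.2 hN'.le))
  have h1 := subset_convexHull ℝ _ (Set.mem_image_of_mem (fun m : ℝ => (m, rateMN N K m))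
    (Set.right_mem_Icc.2 hN'.le))
  have h := (convex_convexHull ℝ _) h0 h1 (a := 1 - M / N) (b := M / N)
    (by linarith [div_le_one_of_le₀ hMN hN'.le]) (by positivity) (by ring)
  convert h using 1
  ext
  · simp [hN'.ne']
  · simp [rateMN, hN'.ne']

theorem convexifiedRateMN_le_div {N : ℕ} (K : ℕ) {M : ℝ} (hM : 0 < M)
    (hMN : M ≤ N) : convexifiedRateMN N K M ≤ (1 - M / N) / (M / N) := by
  have hN' : (0 : ℝ) < N := hM.trans_le hMN
  have hx : M / N ≤ 1 := div_le_one_of_le₀ hMN hN'.le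
  refine (convexifiedRateMN_le
    (subset_convexHull ℝ _ ⟨M, ⟨hM.le, hMN⟩, rfl⟩)).trans ?_
  rw [rateMN, if_neg hM.ne']
  calc ((N : ℝ) - M) * min (1 / M * (1 - (1 - M / N) ^ K)) 1
      ≤ (N - M) * (1 / M * 1) := by
        have : 0 ≤ (1 - M / N) ^ K := pow_nonneg (by linarith) K
        refine mul_le_mul_of_nonneg_left ?_ (by linarith)
        refine (min_le_left _ _).trans ?_
        gcongr
        linarith
    _ = _ := by field_simp

/-- The maximum of `l (1 - l x)` over real `l` is `1 / (4 x)`, at `l = 1 / (2 x)`; rounding `l` to an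
integer of the range `1 ≤ l ≤ m` costs at most the factor `1 - x ^ 2`. -/
theorem exists_nat_le_four_mul {x : ℝ} (hx : 0 < x) (hx1 : x ≤ 1) {m : ℕ} (hm : 1 / 2 < m * x) :
    ∃ l : ℕ, 0 < l ∧ l ≤ m ∧ (1 - x) / x ≤ 4 * (l * (1 - l * x)) := by
  have h0 : (0 : ℝ) ≤ 1 / (2 * x) + 1 / 2 := by positivity
  have h1 := Nat.floor_le h0
  have h2 := Nat.lt_floor_add_one (1 / (2 * x) + 1 / 2)
  set l := ⌊1 / (2 * x) + 1 / 2⌋₊ with hl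
  have hinv : 1 / (2 * x) * (2 * x) = 1 := by field_simp
  refine ⟨l, ?_, ?_, ?_⟩
  · rw [hl, Nat.floor_pos, ← sub_le_iff_le_add, le_div_iff₀ (by positivity)]
    linarith
  · have : (l : ℝ) < m + 1 := by
      have : 1 / (2 * x) < m := by
        rw [div_lt_iff₀ (by positivity)]
        linarith
      linarith
    exact Nat.lt_succ_iff.1 (by exact_mod_cast this)
  · -- Together: `|1 - 2 l x| ≤ x`, the rounding error of `l` being at most `1 / 2`.
    have h3 : 2 * l * x ≤ 1 + x := by nlinarith
    have h4 : 1 - x ≤ 2 * l * x := by nlinarith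
    rw [div_le_iff₀ hx]
    nlinarith

theorem convexifiedRateMN_le_four_mul {N K : ℕ} (hN : 1 ≤ N) (hK : 1 ≤ K) {M r : ℝ} (hM : 0 ≤ M)
    (hMN : M ≤ N) (hr : r ∈ worstCaseRates N K M) : convexifiedRateMN N K M ≤ 4 * r := by
  obtain ⟨R, hR, rfl⟩ := hr
  have hN' : (0 : ℝ) < N := by exact_mod_cast hN
  have hx0 : 0 ≤ M / N := by positivity
  have hx1 : M / N ≤ 1 := div_le_one_of_le₀ hMN hN'.le
  have hlow : ∀ l : ℕ, 0 < l → l ≤ min K N → (l : ℝ) * (1 - l * (M / N)) ≤ ⨆ d, R d :=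
    fun l hl hle => le_of_mem_optimalRegion hR hl (hle.trans (min_le_right _ _))
      (hle.trans (min_le_left _ _))
  have hm : 0 < min K N := by omega
  by_cases hcase : ((min K N : ℕ) : ℝ) * (M / N) ≤ 1 / 2
  · have h1 := convexifiedRateMN_le_chord K hN hM hMN
    rw [← Nat.cast_min] at h1
    have h2 := hlow _ hm le_rfl
    have h3 : (0 : ℝ) < (min K N : ℕ) := by exact_mod_cast hm
    nlinarith
  · push Not at hcase
    have hx : 0 < M / N := by
      by_contra! h
      have := le_antisymm h hx0
      rw [this] at hcase
      norm_num at hcase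
    have hM' : 0 < M := by
      rcases hM.eq_or_lt with rfl | h
      · simp at hx
      · exact h
    obtain ⟨l, hl, hle, h⟩ := exists_nat_le_four_mul hx hx1 hcase
    linarith [convexifiedRateMN_le_div K hM' hMN, hlow l hl hle]

end CodedCaching

theorem theorem3 (N K : ℕ) (hN : 1 ≤ N) (hK : 1 ≤ K) (M : ℝ) (hM : 0 ≤ M) (hMN : M < (N : ℝ)) :
    IsLeast (CodedCaching.worstCaseRates N K M) (CodedCaching.optimalWorstRate N K M) ∧
      0 < CodedCaching.optimalWorstRate N K M ∧
      CodedCaching.convexifiedRateMN N K M / CodedCaching.optimalWorstRate N K M < 4.7 := by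
  obtain ⟨r, hr⟩ := CodedCaching.exists_isLeast_worstCaseRates N K hN hK hM
  rw [CodedCaching.optimalWorstRate, hr.csInf_eq]
  have hpos : 0 < r := by
    obtain ⟨R, hR, hrR⟩ := hr.1
    have h := CodedCaching.le_of_mem_optimalRegion hR one_pos hN hK
    have : M / N < 1 := (div_lt_one (hM.trans_lt hMN)).2 hMN
    rw [← hrR] at h
    norm_num at h
    linarith
  refine ⟨hr, hpos, ?_⟩
  rw [div_lt_iff₀ hpos]
  linarith [CodedCaching.convexifiedRateMN_le_four_mul hN hK hM hMN.le hr.1]
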